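/- Let $N$ be a finite set of players, and let each player $i\in N$ have a finite nonempty set $X_i$ of strategies and a utility function $u_i:\prod_{j\in N}X_j\to\mathbb R$ (an $n$-person matrix game, $n=|N|$). For $i\in N$ let $P_i$ be the set of all probability distributions on $X_i$, and for $p=(p^{(j)})_{j\in N}\in\prod_{j\in N}P_j$ let $$\overline u_i(p)=\sum_{x\in\prod_{j}X_j}u_i(x)\prod_{j\in N}p^{(j)}_{x_j}$$ be the expected utility of player $i$. For $q\in P_i$ let $p_{-i}(q)$ denote the tuple obtained from $p$ by replacing the component $p^{(i)}$ by $q$. Then the randomized game, with strategy sets $P_i$ and utilities $\overline u_i$, has both a gain equilibrium and a cost equilibrium. That is, there is $p\in\prod_{j}P_j$ such that $$\overline u_i(p)\ \ge\ \overline u_i(p_{-i}(q))\quad\text{for all } i\in N \text{ and all } q\in P_i,$$ and there is $p'\in\prod_{j}P_j$ such that $$\overline u_i(p')\ \le\ \overline u_i(p'_{-i}(q))\quad\text{for all } i\in N \text{ and all } q\in P_i.$$ -/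

import Mathlib

universe u v

/-- A game with player set `N` in which player `i` has the set `X i` of strategies. A state is a
joint choice `x : ∀ i, X i`, and `utility i x y` is the value which player `i` assigns to the
transition from the state `x` to the state `y`. -/
structure NPersonGame {N : Type u} (X : N → Type v) where
  utility : N → (∀ i, X i) → (∀ i, X i) → ℝ

namespace NPersonGame

/-- The neighborhood of the state `x` for player `i`: all states that arise from `x` when `i`
replaces the strategy `x i` by some `y : X i` and all other players retain theirs. -/
def neighborhood {N : Type u} [DecidableEq N] {X : N → Type v} (i : N) (x : ∀ j, X j) :
    Set (∀ j, X j) :=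
  {z | ∃ y : X i, z = Function.update x i y}

def IsGainEquilibrium {N : Type u} [DecidableEq N] {X : N → Type v} (Γ : NPersonGame X)
    (x : ∀ i, X i) : Prop :=
  ∀ i : N, ∀ z ∈ neighborhood i x, Γ.utility i x z ≤ Γ.utility i x x

def IsCostEquilibrium {N : Type u} [DecidableEq N] {X : N → Type v} (Γ : NPersonGame X)
    (x : ∀ i, X i) : Prop :=
  ∀ i : N, ∀ z ∈ neighborhood i x, Γ.utility i x x ≤ Γ.utility i x z

end NPersonGame

/-- A matrix game: finite strategy sets, and just one utility function `payoff i` per player. -/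
structure MatrixGame {N : Type u} (X : N → Type v) [∀ i, Fintype (X i)] where
  payoff : N → (∀ i, X i) → ℝ

namespace MatrixGame

/-- A matrix game as a game: the utility of a transition depends only on the state reached. -/
def toNPersonGame {N : Type u} {X : N → Type v} [∀ i, Fintype (X i)] (Γ : MatrixGame X) :
    NPersonGame X where
  utility i _ y := Γ.payoff i y

/-- The expected payoff of player `i` when the players select their strategies independently,
player `j` according to the probability distribution `p j`. -/
noncomputable def expectedPayoff {N : Type u} [Fintype N] [DecidableEq N] {X : N → Type v}
    [∀ i, Fintype (X i)] (Γ : MatrixGame X) (i : N) (p : ∀ j, stdSimplex ℝ (X j)) : ℝ :=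
  ∑ x : ∀ j, X j, Γ.payoff i x * ∏ j, (p j : X j → ℝ) (x j)

/-- The randomization of a matrix game: player `i` chooses a probability distribution on `X i`,
that is, a point of the standard simplex, and its utility is the expected payoff. -/
noncomputable def randomization {N : Type u} [Fintype N] [DecidableEq N] {X : N → Type v}
    [∀ i, Fintype (X i)] (Γ : MatrixGame X) :
    NPersonGame (fun i : N => (stdSimplex ℝ (X i) : Type v)) :=
  (NPersonGame.mk fun i _ q => Γ.expectedPayoff i q)

end MatrixGame

/-! All mixed states are sought in one simplex, on the pairs (player, strategy), scaled by the
number `n` of players. Let `A (i, x)` be the closed set of weights for which player `i` has mass at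
most 1 and `x` is a best pure reply of `i`. The total mass is `n`, so some player has mass at most
1, and these sets cover the simplex.

By `exists_forall_pos_mem_of_isClosed_cover` some point lies in `A a` for every `a` in its support.
All masses are then at most 1 with sum `n`, hence equal to 1, and only best replies are played: a
gain equilibrium. Negated payoffs give the cost equilibrium.

The covering lemma takes the place of a fixed point theorem. It is a limit over finer grids of a
combinatorial statement, which comes from Scarf's lemma `exists_dominant_colorful`, a parity count
of incidences between dominant sets and their facets. -/

open Finset

/-! ### Scarf's lemma on dominant sets -/

section Scarf

variable {I : Type*} {V : Type*}

/-- The set `σ` is dominant for the rankings `r i` of `V`: every `y` is, in some ranking, at most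
the least element of `σ`. -/
def Dominant (r : I → V → ℕ) (σ : Finset V) : Prop :=
  ∀ y, ∃ i, ∀ x ∈ σ, r i y ≤ r i x

theorem Dominant.mono {r : I → V → ℕ} {σ τ : Finset V} (h : Dominant r σ) (hτ : τ ⊆ σ) :
    Dominant r τ := fun y => (h y).imp fun _ hi x hx => hi x (hτ hx)

/-- The element `x` is the greatest in the ranking `r k` among those which exceed the least
element of `τ` in every other ranking. -/
def IsPivot (r : I → V → ℕ) (τ : Finset V) (k : I) (x : V) : Prop :=
  (∀ l, l ≠ k → ∃ t ∈ τ, r l t < r l x) ∧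
    ∀ y, (∀ l, l ≠ k → ∃ t ∈ τ, r l t < r l y) → r k y ≤ r k x

theorem IsPivot.unique {r : I → V → ℕ} (hr : ∀ i, Function.Injective (r i)) {τ : Finset V} {k : I}
    {x y : V} (hx : IsPivot r τ k x) (hy : IsPivot r τ k y) : x = y :=
  hr k (le_antisymm (hy.2 x hx.1) (hx.2 y hy.1))

theorem exists_isPivot [Fintype V] (r : I → V → ℕ) (τ : Finset V) (k : I)
    (h : ∃ x, ∀ l, l ≠ k → ∃ t ∈ τ, r l t < r l x) : ∃ x, IsPivot r τ k x := by
  classical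
  obtain ⟨x, hx⟩ := h
  obtain ⟨z, hz, hmax⟩ := (univ.filter fun x => ∀ l, l ≠ k → ∃ t ∈ τ, r l t < r l x).exists_max_image
    (r k) ⟨x, by simpa using hx⟩
  exact ⟨z, by simpa using hz, fun y hy => hmax y (by simpa using hy)⟩

/-- If `y` exceeds the least element of `τ` in every ranking but `k`, then `k` bounds it, by
maximality of `x`. Otherwise `y` is below `τ` in some `l ≠ k`, where adding `x` leaves the minimum
unchanged. -/
theorem Dominant.insert_of_isPivot [DecidableEq V] {r : I → V → ℕ} {τ : Finset V}
    (hτ : Dominant r τ) {k : I} {x : V} (hx : IsPivot r τ k x) : Dominant r (insert x τ) := by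
  intro y
  by_cases hy : ∀ l, l ≠ k → ∃ t ∈ τ, r l t < r l y
  · obtain ⟨l, hl⟩ := hτ y
    obtain rfl : l = k := by
      by_contra hlk
      obtain ⟨t, ht, hlt⟩ := hy l hlk
      exact absurd (hl t ht) (not_le.2 hlt)
    refine ⟨l, fun z hz => ?_⟩
    rcases mem_insert.1 hz with rfl | hz
    · exact hx.2 y hy
    · exact hl z hz
  · push Not at hy
    obtain ⟨l, hlk, hl⟩ := hy
    refine ⟨l, fun z hz => ?_⟩
    rcases mem_insert.1 hz with rfl | hz
    · obtain ⟨t, ht, hlt⟩ := hx.1 l hlk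
      exact (hl t ht).trans hlt.le
    · exact hl z hz

/-- A dominant set with one element less than there are rankings has two rankings `i ≠ j` with
the same least element, and its dominant one-point extensions are by the pivots of `i` and `j`. -/
theorem Dominant.exists_pair [Fintype I] [DecidableEq V] {r : I → V → ℕ}
    (hr : ∀ i, Function.Injective (r i)) {τ : Finset V} (hτ : Dominant r τ) (hne : τ.Nonempty)
    (hcard : τ.card + 1 = Fintype.card I) :
    ∃ i j, i ≠ j ∧ (∀ x, IsPivot r τ i x → x ∉ τ ∧ ¬ IsPivot r τ j x) ∧
      (∀ x, IsPivot r τ j x → x ∉ τ) ∧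
      ∀ x, x ∉ τ → Dominant r (insert x τ) → IsPivot r τ i x ∨ IsPivot r τ j x := by
  classical
  choose m hm hmin using fun i => τ.exists_min_image (r i) hne
  -- Pigeonhole: there are more rankings than elements of `τ`.
  obtain ⟨i, -, j, -, hij, hmij⟩ := exists_ne_map_eq_of_card_lt_of_maps_to
    (s := (univ : Finset I)) (t := τ) (f := m) (by rw [card_univ]; omega) (fun a _ => hm a)
  have hnot : ∀ a b x, a ≠ b → m a = m b → IsPivot r τ a x → x ∉ τ := by
    intro a b x hab hmab hx hxτ
    obtain ⟨l, hl⟩ := hτ x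
    have hla : l = a := by
      by_contra hla
      obtain ⟨t, ht, hlt⟩ := hx.1 l hla
      exact absurd (hl t ht) (not_le.2 hlt)
    subst hla
    have hxm : x = m l := hr l (le_antisymm (hl _ (hm l)) (hmin l x hxτ))
    obtain ⟨t, ht, hlt⟩ := hx.1 b hab.symm
    rw [hxm, hmab] at hlt
    exact absurd (hmin b t ht) (not_le.2 hlt)
  refine ⟨i, j, hij, fun x hx => ⟨hnot i j x hij hmij hx, fun hxj => ?_⟩,
    fun x hx => hnot j i x hij.symm hmij.symm hx, fun x hxτ hdom => ?_⟩
  · obtain ⟨l, hl⟩ := hτ x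
    by_cases hli : l = i
    · obtain ⟨t, ht, hlt⟩ := hxj.1 l (hli ▸ hij)
      exact absurd (hl t ht) (not_le.2 hlt)
    · obtain ⟨t, ht, hlt⟩ := hx.1 l hli
      exact absurd (hl t ht) (not_le.2 hlt)
  · obtain ⟨k, hk⟩ := hdom x
    -- `S` collects the rankings whose minimum on `τ` survives the insertion of `x`. Dominance at
    -- each `t ∈ τ` makes `t` such a minimum, so `S` omits only `k` and `m` is injective on it. As
    -- `m i = m j`, this forces `k` to be `i` or `j`.
    set S : Finset I := univ.filter fun l => r l (m l) < r l x with hS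
    have hkS : k ∉ S := by
      simp only [hS, mem_filter, mem_univ, true_and, not_lt]
      exact hk _ (mem_insert_of_mem (hm k))
    have hsub : τ ⊆ S.image m := by
      intro t ht
      obtain ⟨l, hl⟩ := hdom t
      have htm : m l = t :=
        hr l (le_antisymm (hmin l t ht) (hl _ (mem_insert_of_mem (hm l))))
      refine mem_image.2 ⟨l, ?_, htm⟩
      simp only [hS, mem_filter, mem_univ, true_and, htm]
      refine lt_of_le_of_ne (hl x (mem_insert_self _ _)) fun h => hxτ ?_
      rwa [← hr l h]
    have hSle : S.card ≤ τ.card := by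
      have : S.card < (univ : Finset I).card := card_lt_card
        (ssubset_univ_iff.2 fun h => hkS (h ▸ mem_univ k))
      rw [card_univ] at this
      omega
    have himg : (S.image m).card = S.card :=
      le_antisymm card_image_le (hSle.trans (card_le_card hsub))
    have hScard : S.card = τ.card := le_antisymm hSle ((card_le_card hsub).trans card_image_le)
    have hSk : S = univ.erase k := by
      refine eq_of_subset_of_card_le (fun l hl => mem_erase.2 ⟨fun h => hkS (h ▸ hl), mem_univ _⟩) ?_
      rw [card_erase_of_mem (mem_univ k), card_univ]
      omega
    have hinj := card_image_iff.1 himg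
    have hpiv : IsPivot r τ k x := by
      have hlt : ∀ l, l ≠ k → r l (m l) < r l x := fun l hl => by
        have : l ∈ S := by simp [hSk, hl]
        simpa [hS] using this
      refine ⟨fun l hl => ⟨m l, hm l, hlt l hl⟩, fun y hy => ?_⟩
      obtain ⟨l, hl⟩ := hdom y
      obtain rfl : l = k := by
        by_contra hlk
        obtain ⟨t, ht, hlt⟩ := hy l hlk
        exact absurd (hl t (mem_insert_of_mem ht)) (not_le.2 hlt)
      exact hl x (mem_insert_self _ _)
    by_cases hki : k = i
    · exact Or.inl (hki ▸ hpiv)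
    by_cases hkj : k = j
    · exact Or.inr (hkj ▸ hpiv)
    refine absurd (hinj ?_ ?_ hmij) hij
    · simp [hSk, Ne.symm hki]
    · simp [hSk, Ne.symm hkj]

/-- A set of vertices with as many elements as there are colours, but without some colour, has an
even number of facets which carry exactly the colours other than `a`. -/
theorem even_card_facets [Fintype I] [DecidableEq I] [DecidableEq V] (c : V → I) (a : I)
    {σ : Finset V} (hσ : σ.card = Fintype.card I) (hc : σ.image c ≠ univ) (D : Finset (Finset V))
    (hD : ∀ τ, τ ∈ D ↔ τ.card + 1 = Fintype.card I ∧ τ.image c = univ.erase a) :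
    Even (D.filter fun τ => τ ⊆ σ).card := by
  rcases (D.filter fun τ => τ ⊆ σ).eq_empty_or_nonempty with h | ⟨τ, hτ⟩
  · simp [h]
  obtain ⟨hτD, hτσ⟩ := mem_filter.1 hτ
  obtain ⟨hτc, hτi⟩ := (hD τ).1 hτD
  obtain ⟨x, hxτ, rfl⟩ : ∃ x, x ∉ τ ∧ insert x τ = σ :=
    exists_eq_insert_iff.2 ⟨hτσ, by omega⟩
  have hxa : c x ≠ a := fun h => hc (by
    rw [image_insert, hτi, h, insert_erase (mem_univ a)])
  have hinj : Set.InjOn c τ := card_image_iff.1 (by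
    rw [hτi, card_erase_of_mem (mem_univ a), card_univ]; omega)
  -- `x` and `y` are the only two vertices of equal colour, so a facet with the required colours
  -- omits one of them.
  obtain ⟨y, hyτ, hy⟩ : ∃ y ∈ τ, c y = c x := by
    have : c x ∈ τ.image c := by rw [hτi]; simp [hxa]
    simpa using this
  have hxy : x ≠ y := fun h => hxτ (h ▸ hyτ)
  have hswap : (insert x (τ.erase y)).image c = univ.erase a := by
    rw [image_insert, ← hy, ← image_insert, insert_erase hyτ, hτi]
  have hxe : x ∉ τ.erase y := fun h => hxτ (mem_of_mem_erase h)
  have hcard : (insert x (τ.erase y)).card = τ.card := by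
    rw [card_insert_of_notMem hxe, card_erase_add_one hyτ]
  have key : (D.filter fun ρ => ρ ⊆ insert x τ) = {τ, insert x (τ.erase y)} := by
    ext ρ
    simp only [mem_filter, mem_insert, mem_singleton]
    constructor
    · rintro ⟨hρD, hρ⟩
      obtain ⟨hρc, hρi⟩ := (hD ρ).1 hρD
      have hρinj : Set.InjOn c ρ := card_image_iff.1 (by
        rw [hρi, card_erase_of_mem (mem_univ a), card_univ]; omega)
      by_cases hxρ : x ∈ ρ
      · right
        refine eq_of_subset_of_card_le (fun z hz => ?_) (by omega)
        rcases mem_insert.1 (hρ hz) with rfl | hzτ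
        · exact mem_insert_self _ _
        · refine mem_insert_of_mem (mem_erase.2 ⟨?_, hzτ⟩)
          rintro rfl
          exact hxy (hρinj hxρ hz hy.symm)
      · left
        exact eq_of_subset_of_card_le ((subset_insert_iff_of_notMem hxρ).1 hρ) (by omega)
    · rintro (rfl | rfl)
      · exact ⟨hτD, hτσ⟩
      · exact ⟨(hD _).2 ⟨by omega, hswap⟩, insert_subset_insert x (erase_subset y τ)⟩
  rw [key, card_pair]
  · exact even_two
  · intro h
    exact hxτ (h ▸ mem_insert_self _ _)

/-- The dominant sets of full size which contain a facet with a proper vertex are even in number. -/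
theorem even_card_cofacets [Fintype I] [Fintype V] [DecidableEq V] {r : I → V → ℕ}
    (hr : ∀ i, Function.Injective (r i)) {s : I → V}
    (htop : ∀ v, v ∉ Set.range s → ∀ i j, j ≠ i → r i v < r i (s j))
    {τ : Finset V} (hcard : τ.card + 1 = Fintype.card I) {t : V} (ht : t ∈ τ)
    (hts : t ∉ Set.range s) (K : Finset (Finset V))
    (hK : ∀ σ, σ ∈ K ↔ σ.card = Fintype.card I ∧ Dominant r σ) :
    Even (K.filter fun σ => τ ⊆ σ).card := by
  rcases (K.filter fun σ => τ ⊆ σ).eq_empty_or_nonempty with h | ⟨σ, hσ⟩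
  · simp [h]
  obtain ⟨hσK, hτσ⟩ := mem_filter.1 hσ
  have hτ : Dominant r τ := ((hK σ).1 hσK).2.mono hτσ
  obtain ⟨i, j, hij, hi, hj, hex⟩ := hτ.exists_pair hr ⟨t, ht⟩ hcard
  -- The slack vertex `s k` beats the proper vertex `t` in every ranking other than `k`, so there
  -- are candidates for the pivot.
  have hpiv : ∀ k, ∃ x, IsPivot r τ k x := fun k =>
    exists_isPivot r τ k ⟨s k, fun l hl => ⟨t, ht, htop t hts l k hl.symm⟩⟩
  obtain ⟨x, hx⟩ := hpiv i
  obtain ⟨y, hy⟩ := hpiv j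
  have hxy : x ≠ y := fun h => (hi x hx).2 (h ▸ hy)
  have key : (K.filter fun σ => τ ⊆ σ) = {insert x τ, insert y τ} := by
    ext ρ
    simp only [mem_filter, mem_insert, mem_singleton]
    constructor
    · rintro ⟨hρK, hτρ⟩
      obtain ⟨hρc, hρ⟩ := (hK ρ).1 hρK
      obtain ⟨z, hz, rfl⟩ : ∃ z, z ∉ τ ∧ insert z τ = ρ :=
        exists_eq_insert_iff.2 ⟨hτρ, by omega⟩
      rcases hex z hz hρ with h | h
      · exact Or.inl (by rw [h.unique hr hx])
      · exact Or.inr (by rw [h.unique hr hy])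
    · rintro (rfl | rfl)
      · exact ⟨(hK _).2 ⟨by rw [card_insert_of_notMem (hi x hx).1, hcard],
          hτ.insert_of_isPivot hx⟩, subset_insert _ _⟩
      · exact ⟨(hK _).2 ⟨by rw [card_insert_of_notMem (hj y hy), hcard],
          hτ.insert_of_isPivot hy⟩, subset_insert _ _⟩
  rw [key, card_pair]
  · exact even_two
  · intro h
    have : x ∈ insert y τ := h ▸ mem_insert_self x τ
    exact (mem_insert.1 this).elim hxy (hi x hx).1

/-- The facet of all slack vertices but one lies in exactly one dominant set of full size. -/
theorem card_cofacets_slack [Fintype I] [DecidableEq I] [Fintype V] [DecidableEq V]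
    {r : I → V → ℕ} (hr : ∀ i, Function.Injective (r i)) {s : I → V}
    (hs : Function.Injective s) (hbot : ∀ i v, r i (s i) ≤ r i v)
    (htop : ∀ v, v ∉ Set.range s → ∀ i j, j ≠ i → r i v < r i (s j))
    (hV : ∃ v, v ∉ Set.range s) (a : I) (K : Finset (Finset V))
    (hK : ∀ σ, σ ∈ K ↔ σ.card = Fintype.card I ∧ Dominant r σ) :
    (K.filter fun σ => (univ.erase a).image s ⊆ σ).card = 1 := by
  classical
  obtain ⟨v, hv⟩ := hV
  obtain ⟨x, hx, hmax⟩ := (univ.filter fun v => v ∉ Set.range s).exists_max_image (r a)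
    ⟨v, by simpa using hv⟩
  replace hx : x ∉ Set.range s := by simpa using hx
  replace hmax : ∀ y, y ∉ Set.range s → r a y ≤ r a x := fun y hy => hmax y (by simpa using hy)
  have hlt : ∀ y, y ∉ Set.range s → ∀ i, ¬ r i y ≤ r i (s i) := fun y hy i h =>
    hy ⟨i, hr i (le_antisymm (hbot i y) h)⟩
  have hcard : ((univ.erase a).image s).card + 1 = Fintype.card I := by
    rw [card_image_of_injective _ hs, card_erase_add_one (mem_univ a), card_univ]
  have hnot : ∀ y, y ∉ Set.range s → y ∉ (univ.erase a).image s := fun y hy h => by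
    obtain ⟨l, -, hl⟩ := mem_image.1 h
    exact hy ⟨l, hl⟩
  have hmem : ∀ l, l ≠ a → s l ∈ (univ.erase a).image s := fun l hl =>
    mem_image_of_mem _ (mem_erase.2 ⟨hl, mem_univ _⟩)
  rw [card_eq_one]
  refine ⟨insert x ((univ.erase a).image s), ?_⟩
  ext ρ
  simp only [mem_filter, mem_singleton]
  constructor
  · rintro ⟨hρK, hτρ⟩
    obtain ⟨hρc, hρ⟩ := (hK ρ).1 hρK
    obtain ⟨z, hz, rfl⟩ : ∃ z, z ∉ (univ.erase a).image s ∧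
        insert z ((univ.erase a).image s) = ρ := exists_eq_insert_iff.2 ⟨hτρ, by omega⟩
    -- In a ranking `l ≠ a` the set contains its bottom element `s l`, so a proper `y` can be
    -- bounded only in ranking `a`.
    have hle : ∀ y, y ∉ Set.range s → r a y ≤ r a z := fun y hy => by
      obtain ⟨l, hl⟩ := hρ y
      obtain rfl : l = a := by
        by_contra hla
        exact hlt y hy l (hl _ (mem_insert_of_mem (hmem l hla)))
      exact hl z (mem_insert_self _ _)
    have hzs : z ∉ Set.range s := by
      rintro ⟨l, rfl⟩
      by_cases hla : l = a
      · subst hla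
        exact hlt v hv l (hle v hv)
      · exact hz (hmem l hla)
    rw [hr a (le_antisymm (hmax z hzs) (hle x hx))]
  · rintro rfl
    refine ⟨(hK _).2 ⟨by rw [card_insert_of_notMem (hnot x hx), hcard], fun y => ?_⟩,
      subset_insert _ _⟩
    by_cases hy : y ∈ Set.range s
    · obtain ⟨l, rfl⟩ := hy
      exact ⟨l, fun z _ => hbot l z⟩
    · refine ⟨a, fun z hz => ?_⟩
      rcases mem_insert.1 hz with rfl | hz
      · exact hmax y hy
      · obtain ⟨l, hl, rfl⟩ := mem_image.1 hz
        exact (htop y hy a l (ne_of_mem_erase hl)).le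

/-- **Scarf's lemma**: for a colouring of `V` that gives the slack vertex `s i` the colour `i`,
some dominant set carries all colours. -/
theorem exists_dominant_colorful [Fintype I] [Nonempty I] [Fintype V]
    {r : I → V → ℕ} (hr : ∀ i, Function.Injective (r i)) {s : I → V}
    (hbot : ∀ i v, r i (s i) ≤ r i v)
    (htop : ∀ v, v ∉ Set.range s → ∀ i j, j ≠ i → r i v < r i (s j))
    (hV : ∃ v, v ∉ Set.range s) (c : V → I) (hc : ∀ i, c (s i) = i) :
    ∃ σ : Finset V, Dominant r σ ∧ ∀ i, ∃ x ∈ σ, c x = i := by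
  classical
  obtain ⟨a⟩ := ‹Nonempty I›
  have hs : Function.Injective s := fun i j h => by rw [← hc i, h, hc j]
  set K : Finset (Finset V) := univ.filter fun σ => σ.card = Fintype.card I ∧ Dominant r σ with hKdef
  have hK : ∀ σ, σ ∈ K ↔ σ.card = Fintype.card I ∧ Dominant r σ := by simp [hKdef]
  set D : Finset (Finset V) := univ.filter fun τ =>
    τ.card + 1 = Fintype.card I ∧ τ.image c = univ.erase a with hDdef
  have hD : ∀ τ, τ ∈ D ↔ τ.card + 1 = Fintype.card I ∧ τ.image c = univ.erase a := by simp [hDdef]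
  by_contra! hcon
  have hcell : ∀ σ ∈ K, Even (D.filter fun τ => τ ⊆ σ).card := fun σ hσ => by
    obtain ⟨hσc, hσd⟩ := (hK σ).1 hσ
    refine even_card_facets c a hσc (fun h => ?_) D hD
    obtain ⟨i, hi⟩ := hcon σ hσd
    have : i ∈ σ.image c := h ▸ mem_univ i
    obtain ⟨x, hx, hxi⟩ := mem_image.1 this
    exact hi x hx hxi
  have hτ₀ : (univ.erase a).image s ∈ D := (hD _).2 ⟨by
    rw [card_image_of_injective _ hs, card_erase_add_one (mem_univ a), card_univ], by
    rw [image_image]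
    have hcs : c ∘ s = id := funext hc
    rw [hcs, image_id]⟩
  have hdoor : ∀ τ ∈ D.erase ((univ.erase a).image s), Even (K.filter fun σ => τ ⊆ σ).card := by
    intro τ hτ
    obtain ⟨hne, hτD⟩ := mem_erase.1 hτ
    obtain ⟨hτc, hτi⟩ := (hD τ).1 hτD
    by_cases h : ∃ t ∈ τ, t ∉ Set.range s
    · obtain ⟨t, ht, hts⟩ := h
      exact even_card_cofacets hr htop hτc ht hts K hK
    · push Not at h
      -- A facet of slack vertices only, with all colours but `a`, is the exceptional one.
      refine absurd (eq_of_subset_of_card_le (fun t ht => ?_) ?_) hne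
      · obtain ⟨i, rfl⟩ := h t ht
        have : c (s i) ∈ τ.image c := mem_image_of_mem c ht
        rw [hτi, hc] at this
        exact mem_image_of_mem s this
      · have := ((hD _).1 hτ₀).1
        omega
  -- Counted by cells, the incidences are even in number; counted by facets, they are odd, since
  -- only the slack facet contributes an odd number, namely 1.
  have hsum : ∑ σ ∈ K, (D.filter fun τ => τ ⊆ σ).card = ∑ τ ∈ D, (K.filter fun σ => τ ⊆ σ).card :=
    sum_card_bipartiteAbove_eq_sum_card_bipartiteBelow (fun σ τ : Finset V => τ ⊆ σ)
  have heven : Even (∑ σ ∈ K, (D.filter fun τ => τ ⊆ σ).card) := even_sum _ hcell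
  rw [hsum, ← add_sum_erase D _ hτ₀, card_cofacets_slack hr hs hbot htop hV a K hK] at heven
  have := even_sum _ hdoor
  rw [Nat.even_add] at heven
  exact Nat.not_even_one (heven.2 this)

end Scarf

/-! ### From grid colourings to closed covers of the simplex -/

section ClosedCover

open Filter Topology

/-- Ties are broken by an enumeration of `V`. This is needed because grid points may share a
coordinate, while Scarf's lemma wants injective rankings. -/
theorem exists_injective_refining {V : Type*} [Fintype V] (g : V → ℕ) :
    ∃ r : V → ℕ, Function.Injective r ∧ ∀ v w, g v < g w → r v < r w := by
  let e := Fintype.equivFin V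
  have hlt : ∀ v w, g v < g w →
      g v * Fintype.card V + (e v : ℕ) < g w * Fintype.card V + (e w : ℕ) := fun v w h => by
    have h1 : (g v + 1) * Fintype.card V ≤ g w * Fintype.card V := Nat.mul_le_mul_right _ h
    have h2 := (e v).isLt
    rw [add_mul, one_mul] at h1
    omega
  refine ⟨fun v => g v * Fintype.card V + (e v : ℕ), fun v w h => ?_, hlt⟩
  rcases lt_trichotomy (g v) (g w) with h' | h' | h'
  · exact absurd h (hlt v w h').ne
  · simp only [h', add_right_inj] at h
    exact e.injective (Fin.ext h)
  · exact absurd h (hlt w v h').ne'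

/-- In a colouring of the grid points of a simplex, some grid point is near to points of every
colour that belongs to a coordinate which is not small. -/
theorem exists_grid_point_near_colors {I : Type*} [Fintype I] [Nonempty I] (n : ℕ)
    (c : (I → ℕ) → I) :
    ∃ z : I → ℕ, ∑ i, z i = n ∧ ∀ i, z i ≤ Fintype.card I ∨
      ∃ w : I → ℕ, ∑ j, w j = n ∧ c w = i ∧
        ∀ j, w j ≤ z j + Fintype.card I ∧ z j ≤ w j + Fintype.card I := by
  classical
  obtain ⟨a⟩ := ‹Nonempty I›
  let T := {t : I → ℕ // t ∈ piAntidiag (univ : Finset I) n}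
  have hT : ∀ t : T, ∑ i, t.1 i = n := fun t => (mem_piAntidiag.1 t.2).1
  have mkT : ∀ t : I → ℕ, ∑ i, t i = n → t ∈ piAntidiag (univ : Finset I) n := fun t ht =>
    mem_piAntidiag.2 ⟨ht, fun i _ => mem_univ i⟩
  let y₀ : T := ⟨Pi.single a n, mkT _ (by simp)⟩
  -- Grid points get values from 1 to `n + 1`, which leaves 0 for the own slack vertex and `n + 2`
  -- for the others.
  let g : I → T ⊕ I → ℕ := fun i => Sum.elim (fun t => t.1 i + 1) fun j => if j = i then 0 else n + 2
  choose r hr hlt using fun i => exists_injective_refining (g i)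
  have hbnd : ∀ (t : T) i, t.1 i ≤ n := fun t i =>
    (single_le_sum (f := t.1) (fun _ _ => Nat.zero_le _) (mem_univ i)).trans (hT t).le
  obtain ⟨σ, hσ, hcol⟩ := exists_dominant_colorful hr (s := Sum.inr)
    (fun i v => by
      by_cases h : v = Sum.inr i
      · rw [h]
      · refine (hlt i _ _ ?_).le
        rcases v with t | j
        · simp [g]
        · have : j ≠ i := fun hj => h (by rw [hj])
          simp [g, this])
    (fun v hv i j hji => by
      rcases v with t | k
      · refine hlt i _ _ ?_
        have := hbnd t i
        simp only [g, Sum.elim_inl, Sum.elim_inr, if_neg hji]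
        omega
      · exact absurd ⟨k, rfl⟩ hv)
    ⟨Sum.inl y₀, by simp⟩ (Sum.elim (fun t => c t.1) id) (fun i => rfl)
  -- For `i ∉ C` the slack vertex, last in ranking `i`, lies in `σ`, so no grid point is bounded
  -- there. Colours in `C` must come from grid points.
  set C : Finset I := univ.filter fun i => Sum.inr i ∉ σ with hC
  have hcolC : ∀ i ∈ C, ∃ t : T, Sum.inl t ∈ σ ∧ c t.1 = i := fun i hi => by
    obtain ⟨x, hx, hxi⟩ := hcol i
    rcases x with t | j
    · exact ⟨t, hx, hxi⟩
    · obtain rfl : j = i := hxi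
      exact absurd hx (mem_filter.1 hi).2
  have hdom : ∀ y : T, ∃ i ∈ C, ∀ t : T, Sum.inl t ∈ σ → y.1 i ≤ t.1 i := fun y => by
    obtain ⟨i, hi⟩ := hσ (Sum.inl y)
    refine ⟨i, mem_filter.2 ⟨mem_univ _, fun h => ?_⟩, fun t ht => ?_⟩
    · exact absurd (hi _ h) (not_le.2 (hlt i _ _ (by simp [g])))
    · by_contra! hty
      exact absurd (hi _ ht) (not_le.2 (hlt i _ _ (by simpa [g] using hty)))
  obtain ⟨k, hk, -⟩ := hdom y₀
  obtain ⟨t₀, ht₀, -⟩ := hcolC k hk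
  have hmins : ∀ i, ∃ m : T, Sum.inl m ∈ σ ∧ ∀ t : T, Sum.inl t ∈ σ → m.1 i ≤ t.1 i := fun i => by
    obtain ⟨m, hm, hmin⟩ := (univ.filter fun t : T => Sum.inl t ∈ σ).exists_min_image
      (fun t => t.1 i) ⟨t₀, by simpa using ht₀⟩
    exact ⟨m, by simpa using hm, fun t ht => hmin t (by simpa using ht)⟩
  choose m hm hmin using hmins
  -- Otherwise raising each minimum on `C` by one and putting the remainder on `k` gives a grid
  -- point that violates dominance. So the minima nearly exhaust `n`, which leaves the points of `σ`
  -- little room to differ.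
  have hsum : n < ∑ i ∈ C, (m i).1 i + C.card := by
    by_contra! hle
    have hy : ∑ j, ((if j ∈ C then (m j).1 j + 1 else 0) +
        (if j = k then n - (∑ i ∈ C, (m i).1 i + C.card) else 0)) = n := by
      rw [sum_add_distrib, sum_ite_mem, univ_inter, sum_add_distrib, sum_ite_eq' univ k]
      simp only [sum_const, smul_eq_mul, mul_one, mem_univ, if_true]
      omega
    obtain ⟨i, hi, hle'⟩ := hdom ⟨_, mkT _ hy⟩
    have := hle' (m i) (hm i)
    simp only [hi, if_true] at this
    omega
  have hCd : C.card ≤ Fintype.card I := card_le_univ C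
  have hin : ∀ t : T, Sum.inl t ∈ σ → ∀ i ∈ C, t.1 i ≤ (m i).1 i + Fintype.card I := by
    intro t ht i hi
    have h1 : ∑ j ∈ C, t.1 j ≤ n :=
      (sum_le_sum_of_subset (subset_univ C)).trans (hT t).le
    have h2 : ∑ j ∈ C.erase i, (m j).1 j ≤ ∑ j ∈ C.erase i, t.1 j :=
      sum_le_sum fun j _ => hmin j t ht
    rw [← add_sum_erase C _ hi] at h1 hsum
    omega
  have hout : ∀ t : T, Sum.inl t ∈ σ → ∀ i, i ∉ C → t.1 i ≤ Fintype.card I := by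
    intro t ht i hi
    have h1 : ∑ j ∈ insert i C, t.1 j ≤ n :=
      (sum_le_sum_of_subset (subset_univ _)).trans (hT t).le
    have h2 : ∑ j ∈ C, (m j).1 j ≤ ∑ j ∈ C, t.1 j := sum_le_sum fun j _ => hmin j t ht
    rw [sum_insert hi] at h1
    omega
  have hnear : ∀ t t' : T, Sum.inl t ∈ σ → Sum.inl t' ∈ σ → ∀ i,
      t.1 i ≤ t'.1 i + Fintype.card I := fun t t' ht ht' i => by
    by_cases hi : i ∈ C
    · exact (hin t ht i hi).trans (Nat.add_le_add_right (hmin i t' ht') _)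
    · exact (hout t ht i hi).trans (Nat.le_add_left _ _)
  refine ⟨t₀.1, hT t₀, fun i => ?_⟩
  by_cases hi : i ∈ C
  · obtain ⟨w, hw, hwi⟩ := hcolC i hi
    exact Or.inr ⟨w.1, hT w, hwi, fun j => ⟨hnear w t₀ hw ht₀ j, hnear t₀ w ht₀ hw j⟩⟩
  · exact Or.inl (hout t₀ ht₀ i hi)

/-- If closed sets `A i` cover the standard simplex, then some point of the simplex lies in `A i`
for every `i` in its support. -/
theorem exists_forall_pos_mem_of_isClosed_cover {I : Type*} [Fintype I] [Nonempty I]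
    (A : I → Set (I → ℝ)) (hA : ∀ i, IsClosed (A i))
    (hcov : ∀ z ∈ stdSimplex ℝ I, ∃ i, z ∈ A i) :
    ∃ z ∈ stdSimplex ℝ I, ∀ i, 0 < z i → z ∈ A i := by
  classical
  -- The mesh `1 / (n + 1)` avoids division by zero.
  let q : ℕ → (I → ℕ) → I → ℝ := fun n w i => (w i : ℝ) / (n + 1)
  have hq : ∀ n w, ∑ i, w i = n + 1 → q n w ∈ stdSimplex ℝ I := fun n w hw => by
    refine ⟨fun i => by positivity, ?_⟩
    have h : (∑ i, (w i : ℝ)) = n + 1 := by exact_mod_cast hw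
    simp only [q, ← sum_div, h]
    exact div_self (by positivity)
  have hcol : ∀ n w, ∃ i, ∑ j, w j = n + 1 → q n w ∈ A i := fun n w => by
    by_cases hw : ∑ j, w j = n + 1
    · exact (hcov _ (hq n w hw)).imp fun i hi _ => hi
    · exact ⟨Classical.arbitrary I, fun h => absurd h hw⟩
  choose c hc using hcol
  choose w hw hnear using fun n : ℕ => exists_grid_point_near_colors (n + 1) (c n)
  obtain ⟨z, hz, φ, hφ, hlim⟩ := (isCompact_stdSimplex ℝ I).tendsto_subseq
    (x := fun n => q n (w n)) (fun n => hq n _ (hw n))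
  refine ⟨z, hz, fun i hi => ?_⟩
  have hsmall : Tendsto (fun n => (Fintype.card I : ℝ) / ((φ n : ℝ) + 1)) atTop (𝓝 0) :=
    ((tendsto_const_div_atTop_nhds_zero_nat (Fintype.card I : ℝ)).comp
      ((tendsto_add_atTop_nat 1).comp hφ.tendsto_atTop)).congr fun n => by simp
  rw [← (hA i).closure_eq, Metric.mem_closure_iff]
  intro ε hε
  have hlimi : Tendsto (fun n => q (φ n) (w (φ n)) i) atTop (𝓝 (z i)) :=
    (tendsto_pi_nhds.1 hlim) i
  -- Since `z i > 0`, coordinate `i` eventually exceeds the grid error, so a point of colour `i`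
  -- lies nearby. Hence `z` is in the closure of `A i`.
  obtain ⟨n, h1, h2, h3⟩ := ((hsmall.eventually_lt hlimi hi).and
    ((hsmall.eventually_lt_const (half_pos hε)).and
      (Metric.tendsto_nhds.1 hlim (ε / 2) (half_pos hε)))).exists
  have hpos : (0 : ℝ) < φ n + 1 := by positivity
  rcases hnear (φ n) i with hle | ⟨v, hv, hvi, hvw⟩
  · have : (w (φ n) i : ℝ) ≤ Fintype.card I := by exact_mod_cast hle
    exact absurd h1 (not_lt.2 (div_le_div_of_nonneg_right this hpos.le))
  · refine ⟨q (φ n) v, hvi ▸ hc (φ n) v hv, ?_⟩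
    have hd : dist (q (φ n) (w (φ n))) (q (φ n) v) ≤ Fintype.card I / ((φ n : ℝ) + 1) := by
      refine (dist_pi_le_iff (by positivity)).2 fun j => ?_
      obtain ⟨ha, hb⟩ := hvw j
      have ha' : (v j : ℝ) ≤ w (φ n) j + Fintype.card I := by exact_mod_cast ha
      have hb' : (w (φ n) j : ℝ) ≤ v j + Fintype.card I := by exact_mod_cast hb
      simp only [q, Real.dist_eq]
      rw [← sub_div, abs_div, abs_of_pos hpos]
      refine div_le_div_of_nonneg_right (abs_le.2 ⟨?_, ?_⟩) hpos.le <;> linarith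
    calc dist z (q (φ n) v) ≤ dist z (q (φ n) (w (φ n))) + dist (q (φ n) (w (φ n))) (q (φ n) v) :=
          dist_triangle _ _ _
      _ < ε / 2 + ε / 2 := by
          rw [dist_comm z]
          exact add_lt_add_of_lt_of_le h3 (hd.trans h2.le)
      _ = ε := add_halves ε

end ClosedCover

/-! ### Equilibria of the randomized game -/

namespace MatrixGame

variable {N : Type u} [Fintype N] [DecidableEq N] {X : N → Type v} [∀ i, Fintype (X i)]

/-- The multilinear extension of the expected payoff to arbitrary weights. -/
noncomputable def weightedPayoff (Γ : MatrixGame X) (i : N) (w : ∀ j, X j → ℝ) : ℝ :=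
  ∑ x : ∀ j, X j, Γ.payoff i x * ∏ j, w j (x j)

open Classical in
/-- The value for player `i` of the pure strategy `y` against the weights `w`. -/
noncomputable def pureValue (Γ : MatrixGame X) (i : N) (w : ∀ j, X j → ℝ) (y : X i) : ℝ :=
  Γ.weightedPayoff i (Function.update w i (Pi.single y 1))

/-- Each product is linear in its factor for `i`. No normalization enters, so this and `pureValue`
make sense at points of the big simplex whose player masses differ from 1. -/
theorem weightedPayoff_update (Γ : MatrixGame X) (i : N) (w : ∀ j, X j → ℝ) (q : X i → ℝ) :
    Γ.weightedPayoff i (Function.update w i q) = ∑ y, q y * Γ.pureValue i w y := by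
  classical
  have hprod : ∀ (q : X i → ℝ) (x : ∀ j, X j), ∏ j, Function.update w i q j (x j) =
      q (x i) * ∏ j ∈ univ.erase i, w j (x j) := fun q x => by
    rw [← mul_prod_erase univ _ (mem_univ i), Function.update_self]
    congr 1
    exact prod_congr rfl fun j hj => by rw [Function.update_of_ne (ne_of_mem_erase hj)]
  simp only [pureValue, weightedPayoff, hprod, mul_sum]
  rw [sum_comm]
  refine sum_congr rfl fun x _ => ?_
  rw [sum_eq_single (x i)]
  · simp only [Pi.single_eq_same]
    ring
  · intro y _ hy
    simp [Pi.single_eq_of_ne hy.symm]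
  · simp

theorem continuous_pureValue (Γ : MatrixGame X) (i : N) (y : X i) :
    Continuous fun w : ∀ j, X j → ℝ => Γ.pureValue i w y := by
  classical
  have hu : Continuous fun w : ∀ j, X j → ℝ =>
      Function.update w i (Pi.single y 1 : X i → ℝ) := continuous_id.update i continuous_const
  refine continuous_finsetSum _ fun x _ => continuous_const.mul <|
    continuous_finsetProd _ fun j _ => ?_
  exact (continuous_apply (x j)).comp ((continuous_apply j).comp hu)

/-- A mixed state in which every strategy of positive probability is a best response. -/
theorem exists_supported_on_best_responses [∀ i, Nonempty (X i)] (Γ : MatrixGame X) :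
    ∃ p : ∀ i, stdSimplex ℝ (X i), ∀ i x, 0 < (p i : X i → ℝ) x →
      ∀ y, Γ.pureValue i (fun j => p j) y ≤ Γ.pureValue i (fun j => p j) x := by
  classical
  -- Without players the big simplex is empty and the covering lemma does not apply.
  rcases isEmpty_or_nonempty N with hN | hN
  · exact ⟨fun i => isEmptyElim i, fun i => isEmptyElim i⟩
  set n : ℝ := (Fintype.card N : ℝ) with hn
  have hn0 : 0 < n := by simp [hn, Fintype.card_pos]
  let W : ((Σ i, X i) → ℝ) → ∀ j, X j → ℝ := fun z j x => n * z ⟨j, x⟩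
  have hW : Continuous W := by fun_prop
  have : Nonempty (Σ i, X i) := ⟨⟨hN.some, Classical.arbitrary _⟩⟩
  obtain ⟨z, hz, hzA⟩ := exists_forall_pos_mem_of_isClosed_cover
    (fun a : Σ i, X i => {z | ∑ x, W z a.1 x ≤ 1 ∧
      ∀ y, Γ.pureValue a.1 (W z) y ≤ Γ.pureValue a.1 (W z) a.2})
    (fun a => by
      have hmass : Continuous fun z => ∑ x, W z a.1 x := by fun_prop
      rw [Set.ofPred_and, Set.ofPred_forall]
      exact (isClosed_le hmass continuous_const).inter <| isClosed_iInter fun y => isClosed_le ((Γ.continuous_pureValue _ y).comp hW)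
        ((Γ.continuous_pureValue _ _).comp hW))
    (fun z hz => by
      obtain ⟨i, hi⟩ : ∃ i, ∑ x, W z i x ≤ 1 := by
        by_contra! h
        have h1 : ∑ _i : N, (1 : ℝ) < ∑ i, ∑ x, W z i x :=
          sum_lt_sum_of_nonempty univ_nonempty fun i _ => h i
        have h2 : ∑ i, ∑ x, W z i x = n := by
          simp only [W, ← mul_sum, ← Fintype.sum_sigma, hz.2, mul_one]
        rw [h2] at h1
        simp [hn] at h1
      obtain ⟨x, hx⟩ := Finite.exists_max (Γ.pureValue i (W z))
      exact ⟨⟨i, x⟩, hi, hx⟩)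
  have hnonneg : ∀ i x, 0 ≤ W z i x := fun i x => mul_nonneg hn0.le (hz.1 _)
  -- Support puts `z` in a set that bounds the mass of `i`; a player without support has mass at
  -- most 0.
  have hle : ∀ i, ∑ x, W z i x ≤ 1 := fun i => by
    by_cases h : ∃ x, 0 < z ⟨i, x⟩
    · obtain ⟨x, hx⟩ := h
      exact (hzA ⟨i, x⟩ hx).1
    · push Not at h
      exact (sum_nonpos fun x _ => mul_nonpos_of_nonneg_of_nonpos hn0.le (h x)).trans zero_le_one
  have htot : ∑ i, ∑ x, W z i x = ∑ _i : N, (1 : ℝ) := by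
    simp only [W, ← mul_sum, ← Fintype.sum_sigma, hz.2, mul_one]
    simp [hn]
  have hone : ∀ i, ∑ x, W z i x = 1 := fun i =>
    (sum_eq_sum_iff_of_le fun i _ => hle i).1 htot i (mem_univ i)
  exact ⟨fun i => ⟨W z i, hnonneg i, hone i⟩, fun i x hx =>
    (hzA ⟨i, x⟩ (pos_of_mul_pos_right hx hn0.le)).2⟩

theorem expectedPayoff_update (Γ : MatrixGame X) (i : N) (p : ∀ j, stdSimplex ℝ (X j))
    (q : stdSimplex ℝ (X i)) :
    Γ.expectedPayoff i (Function.update p i q) =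
      ∑ y, (q : X i → ℝ) y * Γ.pureValue i (fun j => p j) y := by
  rw [← weightedPayoff_update]
  refine sum_congr rfl fun x _ => ?_
  congr 1
  refine prod_congr rfl fun j _ => ?_
  by_cases h : j = i
  · subst h
    simp
  · simp [Function.update_of_ne h]

/-- A payoff is an average of pure values. At `p` only maximal ones carry weight, so no other
average exceeds it. -/
theorem exists_isGainEquilibrium_randomization [∀ i, Nonempty (X i)] (Γ : MatrixGame X) :
    ∃ p : ∀ i, stdSimplex ℝ (X i), Γ.randomization.IsGainEquilibrium p := by
  obtain ⟨p, hp⟩ := Γ.exists_supported_on_best_responses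
  refine ⟨p, ?_⟩
  rintro i _ ⟨q, rfl⟩
  change Γ.expectedPayoff i (Function.update p i q) ≤ Γ.expectedPayoff i p
  obtain ⟨b, hb⟩ := Finite.exists_max (Γ.pureValue i fun j => p j)
  have hpi : Γ.expectedPayoff i p = Γ.pureValue i (fun j => p j) b := by
    conv_lhs => rw [← Function.update_eq_self i p, expectedPayoff_update]
    rw [← one_mul (Γ.pureValue i _ b), ← (p i).2.2, sum_mul]
    refine sum_congr rfl fun x _ => ?_
    have h0 : 0 ≤ (p i : X i → ℝ) x := (p i).2.1 x
    change (p i : X i → ℝ) x * _ = (p i : X i → ℝ) x * _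
    rcases h0.eq_or_lt with h | h
    · rw [← h, zero_mul, zero_mul]
    · rw [le_antisymm (hb x) (hp i x h b)]
  rw [hpi, expectedPayoff_update, ← one_mul (Γ.pureValue i _ b), ← q.2.2, sum_mul]
  exact sum_le_sum fun x _ => mul_le_mul_of_nonneg_left (hb x) (q.2.1 x)

theorem exists_isCostEquilibrium_randomization [∀ i, Nonempty (X i)] (Γ : MatrixGame X) :
    ∃ p : ∀ i, stdSimplex ℝ (X i), Γ.randomization.IsCostEquilibrium p := by
  -- Negating the payoffs exchanges maxima and minima.
  obtain ⟨p, hp⟩ := exists_isGainEquilibrium_randomization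
    (⟨fun i x => -Γ.payoff i x⟩ : MatrixGame X)
  refine ⟨p, fun i z hz => ?_⟩
  have h := hp i z hz
  simpa [randomization, expectedPayoff] using h

end MatrixGame

theorem theoremt {N : Type u} [Fintype N] [DecidableEq N] {X : N → Type v}
    [∀ i, Fintype (X i)] [∀ i, Nonempty (X i)] (Γ : MatrixGame X) :
    (∃ p : ∀ i, stdSimplex ℝ (X i), Γ.randomization.IsGainEquilibrium p) ∧
      (∃ p : ∀ i, stdSimplex ℝ (X i), Γ.randomization.IsCostEquilibrium p) :=
  ⟨Γ.exists_isGainEquilibrium_randomization, Γ.exists_isCostEquilibrium_randomization⟩
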